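/- All graphs and trees are finite. A family of pseudosegments is a family of Jordan arcs (injective continuous images of $[0,1]$) in the Euclidean plane such that any two of them are disjoint or meet in exactly one point, at which they cross; that is, some homeomorphism from a neighbourhood of that point onto an open neighbourhood of the origin in $\mathbb{R}^2$ sends the point to the origin and the two arcs, within that neighbourhood, to the two coordinate axes. A PSI-representation of a graph $G$ is a family of pseudosegments $(s_v)_{v\in V(G)}$ such that distinct vertices $v,w$ are adjacent if and only if $s_v\cap s_w\neq\emptyset$. A graph $G$ is a VPT-graph if there are a tree $T$ and paths $(P_v)_{v\in V(G)}$ in $T$ (single-vertex paths and repetitions are allowed) such that distinct $v,w$ are adjacent if and only if $P_v$ and $P_w$ have a common vertex. (1) Every VPT-graph has a PSI-representation. (2) Let $T$ be a tree with leaves (vertices of degree one) $l_1,\dots,l_m$, and for $1\le i\le j\le m$ let $P_{i,j}=P_{j,i}$ be the path in $T$ from $l_i$ to $l_j$ (so $P_{i,i}$ consists of $l_i$ only). Let $G$ be the vertex intersection graph of all the leaf-paths $P_{i,j}$. Then $G$ has a PSI-representation by pseudosegments $s_{i,j}=s_{j,i}$ corresponding to the paths $P_{i,j}$, and there are pairwise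 disjoint closed disks $R_1,\dots,R_m$ of positive radius such that: (a) $s_{i,j}\cap R_k\neq\emptyset$ if and only if $k=i$ or $k=j$; moreover $s_{i,j}\cap R_i$ and $s_{i,j}\cap R_j$ are Jordan arcs. (b) Any two distinct pseudosegments that intersect $R_i$ cross in the interior of $R_i$. -/

import Mathlib

/-- The intersection graph of a family of sets: distinct indices are adjacent exactly if
their sets meet. -/
def intersectionGraph {ι α : Type*} (S : ι → Set α) : SimpleGraph ι where
  Adj i j := i ≠ j ∧ (S i ∩ S j).Nonempty
  symm := ⟨fun _ _ h => ⟨h.1.symm, by rw [Set.inter_comm]; exact h.2⟩⟩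
  loopless := ⟨fun _ h => h.1 rfl⟩

/-- `P` is the vertex set of a path of `T` (paths with a single vertex are allowed). -/
def IsPathVertexSet {W : Type*} (T : SimpleGraph W) (P : Set W) : Prop :=
  ∃ (a b : W) (p : T.Walk a b), p.IsPath ∧ P = {w | w ∈ p.support}

/-- `G` is a VPT-graph: the vertex intersection graph of a family of paths in a finite tree. Since
finite trees are considered up to isomorphism, it is enough that the node set is a finite type
in the lowest universe. -/
def IsVPT {V : Type*} (G : SimpleGraph V) : Prop :=
  ∃ (W : Type) (_ : Finite W) (T : SimpleGraph W) (P : V → Set W),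
    T.IsTree ∧ (∀ v, IsPathVertexSet T (P v)) ∧ G = intersectionGraph P

/-- The Euclidean plane. -/
abbrev Plane : Type := EuclideanSpace ℝ (Fin 2)

/-- A Jordan arc: an injective continuous image of the unit interval. -/
def IsJordanArc (A : Set Plane) : Prop :=
  ∃ γ : unitInterval → Plane, Continuous γ ∧ Function.Injective γ ∧ Set.range γ = A

/-- `A` and `B` cross at `x`: some local homeomorphism around `x` that sends `x` to the origin
straightens `A` to the horizontal and `B` to the vertical coordinate axis. In particular `x` is an
inner point of both arcs, and each arc passes there from one side of the other to the other. -/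
def CrossAt (A B : Set Plane) (x : Plane) : Prop :=
  ∃ φ : OpenPartialHomeomorph Plane Plane, x ∈ φ.source ∧ φ x = 0 ∧
    ∀ y ∈ φ.source, (y ∈ A ↔ φ y 1 = 0) ∧ (y ∈ B ↔ φ y 0 = 0)

/-- A family of pseudosegments: Jordan arcs in the plane any two of which are disjoint or meet
in a single point and cross there. -/
def IsPseudosegmentFamily {ι : Type*} (s : ι → Set Plane) : Prop :=
  (∀ i, IsJordanArc (s i)) ∧
    ∀ i j, i ≠ j → Disjoint (s i) (s j) ∨ ∃ x, s i ∩ s j = {x} ∧ CrossAt (s i) (s j) x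

/-- The family `s` is a PSI-representation of `G`. -/
def IsPSIRepresentation {V : Type*} (G : SimpleGraph V) (s : V → Set Plane) : Prop :=
  IsPseudosegmentFamily s ∧ G = intersectionGraph s

/-- The leaves of a tree: the nodes with exactly one neighbour. -/
abbrev Leaf {W : Type*} (T : SimpleGraph W) : Type _ := {l : W // ∃! w, T.Adj l w}

/-- For an unordered pair `e` of (possibly equal) leaves of the tree `T`, the vertex set of the
path of `T` that joins them. -/
def leafPath {W : Type*} (T : SimpleGraph W) (e : Sym2 (Leaf T)) : Set W :=
  {w | ∃ (a b : Leaf T) (p : T.Walk a.1 b.1), e = s(a, b) ∧ p.IsPath ∧ w ∈ p.support}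

/-! Root the tree and give each of the finitely many labels a node. The path between two labels has
a highest node, and the labels below that node form the cluster of the pair. Clusters are laminar,
and two paths meet if and only if each of them has an end in the cluster of the other.

Place the labels on the parabola `y = x ^ 2`, at abscissae that realize the clusters on very
different scales: around the cluster of a pair there is an interval much longer than the square of
the diameter of the cluster, yet much shorter than the distance to any other label. Represent the
pair by the part of its secant (a tangent if the labels coincide) over this interval. Two secants
meet at `x` if and only if `(x - a) * (x - b) = (x - d) * (x - g)`, where `a, b` and `d, g` are the
abscissae of the pairs. If `d` and `g` lie far outside the interval of `a, b`, the right-hand side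
is too large for this to happen over that interval. If one of them lies in the cluster, the
difference of the two sides has a root in the interval: by the intermediate value theorem if only
one does, and because `a + b` and `d + g` differ by at least `1` if both do.

All segments of a label pass through its point of the parabola, so small disks around these points
satisfy (a) and (b). For (1), the ends of the given paths serve as pairwise different labels. -/

section Line

/-- The part over the interval `[a, b]` of the line with slope `m` and intercept `q`. -/
def lineSegment (m q a b : ℝ) : Set Plane :=
  {p | p 0 ∈ Set.Icc a b ∧ p 1 = m * p 0 + q}

variable {m q a b m' q' a' b' : ℝ}

theorem isClosed_lineSegment : IsClosed (lineSegment m q a b) :=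
  (isClosed_Icc.preimage (by fun_prop)).inter (isClosed_eq (by fun_prop) (by fun_prop))

theorem isJordanArc_lineSegment (hab : a < b) : IsJordanArc (lineSegment m q a b) := by
  let x (u : unitInterval) : ℝ := ((iccHomeoI a b hab).symm u : ℝ)
  have hx : Continuous x := by fun_prop
  refine ⟨fun u => !₂[x u, m * x u + q], by fun_prop, fun u v huv => ?_, ?_⟩
  · exact (iccHomeoI a b hab).symm.injective (Subtype.ext (congrArg (fun p : Plane => p 0) huv))
  · ext p
    constructor
    · rintro ⟨u, rfl⟩
      exact ⟨((iccHomeoI a b hab).symm u).2, rfl⟩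
    · rintro ⟨hp, hline⟩
      refine ⟨iccHomeoI a b hab ⟨p 0, hp⟩, ?_⟩
      have hpx : x (iccHomeoI a b hab ⟨p 0, hp⟩) = p 0 := by
        simp only [x, Homeomorph.symm_apply_apply]
      ext n
      fin_cases n <;> simp [hpx, hline]

theorem lineSegment_inter_closedBall {z : Plane} (hz : z 1 = m * z 0 + q) (r : ℝ) :
    lineSegment m q a b ∩ Metric.closedBall z r =
      lineSegment m q (max a (z 0 - r / √(1 + m ^ 2))) (min b (z 0 + r / √(1 + m ^ 2))) := by
  have hpos : 0 < √(1 + m ^ 2) := Real.sqrt_pos.2 (by positivity)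
  have mem_closedBall_iff (p : Plane) (hp : p 1 = m * p 0 + q) :
      p ∈ Metric.closedBall z r ↔
        p 0 ∈ Set.Icc (z 0 - r / √(1 + m ^ 2)) (z 0 + r / √(1 + m ^ 2)) := by
    have hdist : dist p z = |z 0 - p 0| * √(1 + m ^ 2) := by
      rw [EuclideanSpace.dist_eq, Fin.sum_univ_two, Real.dist_eq, Real.dist_eq, sq_abs, sq_abs,
        hp, hz, ← Real.sqrt_sq_eq_abs, ← Real.sqrt_mul (sq_nonneg _)]
      ring_nf
    rw [Metric.mem_closedBall, hdist, ← le_div_iff₀ hpos, Set.mem_Icc_iff_abs_le]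
  ext p
  simp only [lineSegment, Set.mem_inter_iff, Set.mem_ofPred_eq, ← Set.Icc_inter_Icc]
  constructor
  · exact fun ⟨⟨hab, hp⟩, hball⟩ => ⟨⟨hab, (mem_closedBall_iff p hp).1 hball⟩, hp⟩
  · exact fun ⟨⟨hab, hball⟩, hp⟩ => ⟨⟨hab, hp⟩, (mem_closedBall_iff p hp).2 hball⟩

theorem isJordanArc_lineSegment_inter_closedBall {z : Plane} (hz : z 0 ∈ Set.Ioo a b)
    (hzline : z 1 = m * z 0 + q) {r : ℝ} (hr : 0 < r) :
    IsJordanArc (lineSegment m q a b ∩ Metric.closedBall z r) := by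
  have hr' : 0 < r / √(1 + m ^ 2) := by positivity
  rw [lineSegment_inter_closedBall hzline]
  refine isJordanArc_lineSegment (lt_trans (b := z 0) ?_ ?_)
  · exact max_lt hz.1 (by linarith)
  · exact lt_min hz.2 (by linarith)

/-- The coordinate change that sends the lines with slopes `m` and `m'` and intercepts `q` and `q'`
to the horizontal and the vertical axis. -/
noncomputable def straighten (h : m ≠ m') (q q' : ℝ) : Plane ≃ₜ Plane where
  toFun p := !₂[p 1 - (m' * p 0 + q'), p 1 - (m * p 0 + q)]
  invFun p := !₂[(p 0 - p 1 - (q - q')) / (m - m'),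
    p 1 + (m * ((p 0 - p 1 - (q - q')) / (m - m')) + q)]
  left_inv p := by
    have : m - m' ≠ 0 := sub_ne_zero.2 h
    ext n
    fin_cases n <;>
    · simp only [Fin.isValue, Fin.zero_eta, Fin.mk_one, Matrix.cons_val_zero, Matrix.cons_val_one,
        Matrix.cons_val_fin_one, sub_sub_sub_cancel_left]
      field_simp
      ring
  right_inv p := by
    have : m - m' ≠ 0 := sub_ne_zero.2 h
    ext n
    fin_cases n
    · simp only [Fin.isValue, Fin.zero_eta, Matrix.cons_val_zero, Matrix.cons_val_one,
        Matrix.cons_val_fin_one, add_sub_cancel_right]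
      field_simp
      ring
    · simp
  continuous_toFun := by fun_prop
  continuous_invFun := by fun_prop

theorem crossAt_lineSegment (hm : m ≠ m') {z : Plane} (hz : z 0 ∈ Set.Ioo a b)
    (hz' : z 0 ∈ Set.Ioo a' b') (hline : z 1 = m * z 0 + q) (hline' : z 1 = m' * z 0 + q') :
    CrossAt (lineSegment m q a b) (lineSegment m' q' a' b') z := by
  have hopen : IsOpen {p : Plane | p 0 ∈ Set.Ioo a b ∩ Set.Ioo a' b'} :=
    (isOpen_Ioo.inter isOpen_Ioo).preimage (by fun_prop)
  refine ⟨(straighten hm q q').toOpenPartialHomeomorph.restrOpen _ hopen,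
    ⟨trivial, hz, hz'⟩, ?_, ?_⟩
  · ext n
    fin_cases n
    · simp [straighten, hline']
    · simp [straighten, hline]
  · rintro y ⟨-, hy, hy'⟩
    simp [straighten, lineSegment, hy.1.le, hy.2.le, hy'.1.le, hy'.2.le, sub_eq_zero]

theorem lineSegment_inter_lineSegment (hm : m ≠ m') {z : Plane} (hz : z ∈ lineSegment m q a b)
    (hz' : z ∈ lineSegment m' q' a' b') :
    lineSegment m q a b ∩ lineSegment m' q' a' b' = {z} := by
  refine Set.eq_singleton_iff_unique_mem.2 ⟨⟨hz, hz'⟩, ?_⟩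
  rintro p ⟨⟨-, hp⟩, -, hp'⟩
  have hmul : (m - m') * (p 0 - z 0) = 0 := by linarith [hz.2, hz'.2]
  have h0 : p 0 = z 0 := sub_eq_zero.1 ((mul_eq_zero.1 hmul).resolve_left (sub_ne_zero.2 hm))
  ext n
  fin_cases n
  · exact h0
  · simp [hp, hz.2, h0]

end Line

theorem exists_radius_disjoint_closedBall {L E X : Type*} [Finite L] [Finite E] [MetricSpace X]
    {z : L → X} (hz : z.Injective) {s : E → Set X} (hs : ∀ e, IsClosed (s e)) :
    ∃ r > 0, (∀ i j, i ≠ j → Disjoint (Metric.closedBall (z i) r) (Metric.closedBall (z j) r)) ∧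
      ∀ e k, z k ∉ s e → Disjoint (s e) (Metric.closedBall (z k) r) := by
  have hballs : ∀ᶠ r in nhdsWithin (0 : ℝ) (Set.Ioi 0), ∀ i j, i ≠ j →
      Disjoint (Metric.closedBall (z i) r) (Metric.closedBall (z j) r) := by
    simp only [Filter.eventually_all]
    intro i j hij
    filter_upwards [Ioo_mem_nhdsGT (half_pos (dist_pos.2 (hz.ne hij)))] with r hr
    exact Metric.closedBall_disjoint_closedBall (by linarith [hr.2])
  have hsets : ∀ᶠ r in nhdsWithin (0 : ℝ) (Set.Ioi 0), ∀ e k, z k ∉ s e →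
      Disjoint (s e) (Metric.closedBall (z k) r) := by
    simp only [Filter.eventually_all]
    intro e k hk
    obtain ⟨ε, hε, hball⟩ := Metric.isOpen_iff.1 (hs e).isOpen_compl (z k) hk
    filter_upwards [Ioo_mem_nhdsGT hε] with r hr
    exact Set.disjoint_right.2 fun p hp => hball (Metric.closedBall_subset_ball hr.2 hp)
  obtain ⟨r, ⟨h₁, h₂⟩, hr⟩ := ((hballs.and hsets).and self_mem_nhdsWithin).exists
  exact ⟨r, hr, h₁, h₂⟩

section Secant

/-- The height over `x` of the secant of the parabola `y = x ^ 2` through the points with the two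
abscissae in `e`; it is the tangent if they coincide. -/
def secant (e : Sym2 ℝ) (x : ℝ) : ℝ :=
  e.add * x - e.mul

theorem secant_eq_secant_iff {a b d g x : ℝ} :
    secant s(a, b) x = secant s(d, g) x ↔ (x - a) * (x - b) = (x - d) * (x - g) := by
  simp only [secant, Sym2.add_mk, Sym2.mul_mk]
  constructor <;> intro h <;> linarith

theorem sq_eq_secant_iff {e : Sym2 ℝ} {x : ℝ} : x ^ 2 = secant e x ↔ x ∈ e := by
  induction e with | _ a b
  have hfactor : x ^ 2 - secant s(a, b) x = (x - a) * (x - b) := by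
    simp only [secant, Sym2.add_mk, Sym2.mul_mk]
    ring
  rw [← sub_eq_zero, hfactor, mul_eq_zero, sub_eq_zero, sub_eq_zero, Sym2.mem_iff]

theorem secant_map_neg (e : Sym2 ℝ) (x : ℝ) : secant (e.map Neg.neg) (-x) = secant e x := by
  induction e
  simp only [secant, Sym2.map_mk, Sym2.add_mk, Sym2.mul_mk]
  ring

variable {e f : Sym2 ℝ} {c ρ : ℝ}

theorem exists_secant_eq_secant_of_near (he : ∀ a ∈ e, 4 * (a - c) ^ 2 < ρ)
    (hf : ∀ d ∈ f, 4 * (d - c) ^ 2 < ρ) (hef : 1 ≤ |e.add - f.add|) :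
    ∃ x, 2 * |x - c| < ρ ∧ secant e x = secant f x := by
  induction e with | _ a b
  induction f with | _ d g
  simp only [Sym2.ball, Sym2.add_mk] at he hf hef
  set σ := a + b - (d + g)
  have hσ : σ ≠ 0 := fun h => by norm_num [h] at hef
  set δ := (a - c) * (b - c) - (d - c) * (g - c) with hδ
  refine ⟨c + δ / σ, ?_, ?_⟩
  · have abs_mul_lt {u v : ℝ} (hu : 4 * u ^ 2 < ρ) (hv : 4 * v ^ 2 < ρ) : |u * v| < ρ / 4 := by
      rw [abs_lt]
      constructor <;> nlinarith [sq_nonneg (u - v), sq_nonneg (u + v)]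
    have hδρ : |δ| < ρ / 2 := by
      linarith [abs_sub ((a - c) * (b - c)) ((d - c) * (g - c)), abs_mul_lt he.1 he.2,
        abs_mul_lt hf.1 hf.2]
    rw [add_sub_cancel_left, abs_div]
    linarith [div_le_self (abs_nonneg δ) hef]
  · rw [secant_eq_secant_iff]
    have hx : σ * (δ / σ) = δ := mul_div_cancel₀ δ hσ
    linear_combination hδ - hx

theorem exists_secant_eq_secant_of_lt (hρ : 0 < ρ) (he : ∀ a ∈ e, 4 * |a - c| ≤ ρ) {d g : ℝ}
    (hd : 4 * |d - c| ≤ ρ) (hg : 8 * ρ < g - c) :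
    ∃ x, |x - c| < ρ ∧ secant e x = secant s(d, g) x := by
  induction e with | _ a b
  simp only [Sym2.ball] at he
  obtain ⟨-, ha₂⟩ := abs_le.1 (show |a - c| ≤ ρ / 4 by linarith)
  obtain ⟨hb₁, hb₂⟩ := abs_le.1 (show |b - c| ≤ ρ / 4 by linarith)
  obtain ⟨hd₁, hd₂⟩ := abs_le.1 (show |d - c| ≤ ρ / 4 by linarith)
  let gap (x : ℝ) : ℝ := (x - a) * (x - b) - (x - d) * (x - g)
  have hleft : gap (c - ρ) < 0 := by
    simp only [gap]
    have near : (ρ + (a - c)) * (ρ + (b - c)) ≤ 5 / 4 * ρ * (5 / 4 * ρ) :=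
      mul_le_mul (by linarith) (by linarith) (by linarith) (by linarith)
    have far : 3 / 4 * ρ * (8 * ρ) ≤ (ρ + (d - c)) * (ρ + (g - c)) :=
      mul_le_mul (by linarith) (by linarith) (by linarith) (by linarith)
    nlinarith [mul_pos hρ hρ]
  have hright : 0 < gap (c + ρ) := by
    have near : 0 < (c + ρ - a) * (c + ρ - b) := mul_pos (by linarith) (by linarith)
    have far : (c + ρ - d) * (c + ρ - g) < 0 := mul_neg_of_pos_of_neg (by linarith) (by linarith)
    simp only [gap]
    linarith
  obtain ⟨x, hx, hgap⟩ := intermediate_value_Ioo (f := gap) (show c - ρ ≤ c + ρ by linarith)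
    (by fun_prop) ⟨hleft, hright⟩
  exact ⟨x, abs_lt.2 ⟨by linarith [hx.1], by linarith [hx.2]⟩,
    secant_eq_secant_iff.2 (sub_eq_zero.1 hgap)⟩

theorem exists_secant_eq_secant_of_near_far (hρ : 0 < ρ) (he : ∀ a ∈ e, 4 * |a - c| ≤ ρ)
    {d g : ℝ} (hd : 4 * |d - c| ≤ ρ) (hg : 8 * ρ < |g - c|) :
    ∃ x, |x - c| < ρ ∧ secant e x = secant s(d, g) x := by
  rcases lt_abs.1 hg with hg | hg
  · exact exists_secant_eq_secant_of_lt hρ he hd hg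
  · have neg_sub_neg_abs (a : ℝ) : |-a - -c| = |a - c| := by rw [neg_sub_neg, abs_sub_comm]
    have he' : ∀ a ∈ e.map Neg.neg, 4 * |a - -c| ≤ ρ := by
      intro _ ha'
      obtain ⟨a, ha, rfl⟩ := Sym2.mem_map.1 ha'
      exact (neg_sub_neg_abs a).symm ▸ he a ha
    obtain ⟨x, hx, hsec⟩ := exists_secant_eq_secant_of_lt hρ he'
      (d := -d) (by rwa [neg_sub_neg_abs]) (g := -g) (by linarith)
    refine ⟨-x, by rwa [← neg_sub_neg_abs, neg_neg], ?_⟩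
    rw [← secant_map_neg, ← secant_map_neg s(d, g), neg_neg, hsec, Sym2.map_mk]

theorem add_ne_add_of_near_far (he : ∀ a ∈ e, 4 * |a - c| ≤ ρ)
    {d g : ℝ} (hd : 4 * |d - c| ≤ ρ) (hg : 8 * ρ < |g - c|) : e.add ≠ d + g := by
  induction e with | _ a b
  simp only [Sym2.ball, Sym2.add_mk] at he ⊢
  intro h
  have hgc : g - c = (a - c) + (b - c) - (d - c) := by linarith
  have := abs_sub ((a - c) + (b - c)) (d - c)
  have := abs_add_le (a - c) (b - c)
  rw [hgc] at hg
  linarith [abs_nonneg (d - c)]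

theorem secant_ne_secant_of_far (he : ∀ a ∈ e, 4 * |a - c| ≤ ρ)
    (hf : ∀ d ∈ f, 8 * ρ < |d - c|) {x : ℝ} (hx : |x - c| ≤ ρ) : secant e x ≠ secant f x := by
  have hρ : 0 ≤ ρ := (abs_nonneg _).trans hx
  have near : ∀ a ∈ e, |x - a| ≤ 2 * ρ := fun a ha => by
    linarith [abs_sub_le x c a, abs_sub_comm c a, he a ha]
  have far : ∀ d ∈ f, 7 * ρ < |x - d| := fun d hd => by
    linarith [abs_sub_le d x c, abs_sub_comm x d, hf d hd]
  induction e with | _ a b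
  induction f with | _ d g
  simp only [Sym2.ball] at near far
  rw [Ne, secant_eq_secant_iff]
  intro h
  have h' : |x - a| * |x - b| = |x - d| * |x - g| := by rw [← abs_mul, ← abs_mul, h]
  have hle := mul_le_mul near.1 near.2 (abs_nonneg _) (by linarith)
  have hlt := mul_lt_mul'' far.1 far.2 (by linarith) (by linarith)
  nlinarith

end Secant

section Scale

/-- A hierarchy of lengths, in which each length exceeds four times the square of the sum of ten
times all the shorter ones. -/
def scale : ℕ → ℝ
  | 0 => 4
  | n + 1 => (22 * scale n) ^ 2

theorem four_le_scale (n : ℕ) : 4 ≤ scale n := by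
  induction n with
  | zero => rfl
  | succ n ih => rw [scale]; nlinarith

theorem two_mul_scale_le_succ (n : ℕ) : 2 * scale n ≤ scale (n + 1) := by
  rw [scale]; nlinarith [four_le_scale n]

theorem scale_monotone : Monotone scale :=
  monotone_nat_of_le_succ fun n => by linarith [two_mul_scale_le_succ n, four_le_scale n]

theorem two_mul_scale_le {m n : ℕ} (h : m < n) : 2 * scale m ≤ scale n :=
  (two_mul_scale_le_succ m).trans (scale_monotone h)

theorem sum_scale_nonneg (s : Finset ℕ) : 0 ≤ ∑ m ∈ s, 10 * scale m :=
  Finset.sum_nonneg fun m _ => by linarith [four_le_scale m]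

theorem four_mul_sum_scale_sq_lt (n : ℕ) :
    4 * (∑ m ∈ Finset.range n, 10 * scale m) ^ 2 < scale n := by
  induction n with
  | zero => simp [scale]
  | succ n ih =>
    rw [Finset.sum_range_succ, scale]
    have hnonneg := sum_scale_nonneg (Finset.range n)
    set S := ∑ m ∈ Finset.range n, 10 * scale m
    have hS : S ≤ scale n := by nlinarith [four_le_scale n]
    nlinarith [four_le_scale n]

theorem four_mul_sum_scale_le (n : ℕ) : 4 * ∑ m ∈ Finset.range n, 10 * scale m ≤ scale n := by
  nlinarith [four_mul_sum_scale_sq_lt n, four_le_scale n, sum_scale_nonneg (Finset.range n)]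

variable {N : Type*} {κ : N → ℕ}

theorem abs_sum_mul_scale_le (hκ : κ.Injective) (s : Finset N) {c : N → ℤ} {K : ℤ} {n : ℕ}
    (hK : 0 ≤ K) (hc : ∀ u, |c u| ≤ K) (hn : ∀ u ∈ s, c u ≠ 0 → κ u < n) :
    |∑ u ∈ s, c u * (10 * scale (κ u))| ≤ K * ∑ m ∈ Finset.range n, 10 * scale m := by
  have hpos (m : ℕ) : 0 ≤ 10 * scale m := by linarith [four_le_scale m]
  have hmem : ∀ u ∈ s.filter (c · ≠ 0), κ u ∈ Finset.range n := fun u hu =>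
    Finset.mem_range.2 (hn u (Finset.mem_filter.1 hu).1 (Finset.mem_filter.1 hu).2)
  calc |∑ u ∈ s, c u * (10 * scale (κ u))|
      = |∑ u ∈ s.filter (c · ≠ 0), c u * (10 * scale (κ u))| := by
        rw [Finset.sum_filter_of_ne fun u _ h => Int.cast_ne_zero.1 (left_ne_zero_of_mul h)]
    _ ≤ ∑ u ∈ s.filter (c · ≠ 0), |c u * (10 * scale (κ u))| := Finset.abs_sum_le_sum_abs _ _
    _ ≤ ∑ u ∈ s.filter (c · ≠ 0), K * (10 * scale (κ u)) :=
        Finset.sum_le_sum fun u _ => by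
          rw [abs_mul, abs_of_nonneg (hpos _)]
          exact mul_le_mul_of_nonneg_right (by exact_mod_cast hc u) (hpos _)
    _ = ∑ m ∈ (s.filter (c · ≠ 0)).image κ, K * (10 * scale m) :=
        (Finset.sum_image (f := fun m => K * (10 * scale m)) hκ.injOn).symm
    _ ≤ ∑ m ∈ Finset.range n, K * (10 * scale m) :=
        Finset.sum_le_sum_of_subset_of_nonneg (Finset.image_subset_iff.2 hmem)
          fun m _ _ => mul_nonneg (by exact_mod_cast hK) (hpos m)
    _ = K * ∑ m ∈ Finset.range n, 10 * scale m := (Finset.mul_sum _ _ _).symm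

theorem nine_mul_scale_le_abs_sum [Fintype N] (hκ : κ.Injective) {c : N → ℤ}
    (hc : ∀ u, |c u| ≤ 2) {v : N} (hv : c v ≠ 0) :
    9 * scale (κ v) ≤ |∑ u, c u * (10 * scale (κ u))| := by
  classical
  obtain ⟨w, hw, hmax⟩ := (Finset.univ.filter (c · ≠ 0)).exists_max_image κ ⟨v, by simpa using hv⟩
  simp only [Finset.mem_filter_univ] at hw hmax
  have hrest := abs_sum_mul_scale_le hκ (Finset.univ.erase w) (n := κ w) zero_le_two hc
    fun u hu hcu => (hmax u hcu).lt_of_ne (hκ.ne (Finset.ne_of_mem_erase hu))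
  have hlead : 10 * scale (κ w) ≤ |c w * (10 * scale (κ w))| := by
    have hcw : (1 : ℝ) ≤ |(c w : ℝ)| := by exact_mod_cast Int.one_le_abs hw
    rw [abs_mul, abs_of_pos (by linarith [four_le_scale (κ w)] : 0 < 10 * scale (κ w))]
    nlinarith [four_le_scale (κ w)]
  have hsplit := Finset.add_sum_erase _ (fun u => c u * (10 * scale (κ u))) (Finset.mem_univ w)
  have := abs_sub_abs_le_abs_add (c w * (10 * scale (κ w)))
    (∑ u ∈ Finset.univ.erase w, c u * (10 * scale (κ u)))
  rw [hsplit] at this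
  push_cast at hrest
  linarith [scale_monotone (hmax v hv), four_mul_sum_scale_le (κ w), four_le_scale (κ w)]

end Scale

theorem exists_injective_strictMono_nat (N : Type*) [Finite N] [PartialOrder N] :
    ∃ κ : N → ℕ, κ.Injective ∧ StrictMono κ := by
  classical
  have := Fintype.ofFinite N
  have : Fintype (LinearExtension N) := ‹Fintype N›
  let f := Fintype.orderIsoFinOfCardEq (LinearExtension N) rfl
  have hinj : Function.Injective fun n : N => (f.symm (toLinearExtension n) : ℕ) :=
    fun a b h => f.symm.injective (Fin.ext h)
  exact ⟨_, hinj, Monotone.strictMono_of_injective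
    (fun a b hab => f.symm.monotone (toLinearExtension.monotone hab)) hinj⟩

section Laminar

variable {L : Type*} {F : Set (Set L)}

/-- A family of sets is laminar if any two of its members are nested or disjoint. -/
def IsLaminar (F : Set (Set L)) : Prop :=
  ∀ A ∈ F, ∀ B ∈ F, A ⊆ B ∨ B ⊆ A ∨ Disjoint A B

theorem IsLaminar.ssubset_of_mem_of_notMem (hF : IsLaminar F) {A C : Set L} (hC : C ∈ F)
    (hA : A ∈ F) {i j : L} (hi : i ∈ A) (hj : j ∈ A) (hiC : i ∈ C) (hjC : j ∉ C) : C ⊂ A := by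
  rcases hF C hC A hA with hCA | hAC | hdisj
  · exact hCA.ssubset_of_mem_notMem hj hjC
  · exact absurd (hAC hj) hjC
  · exact absurd hi (hdisj.notMem_of_mem_left hiC)

/-- Positions `t` of labels on the real line and radii `ρ` of label sets that exhibit the members of
a laminar family as nested clusters of labels. A radius exceeds even the square of the diameter of
its cluster, while all other labels are much farther away than the radius. -/
structure IsLaminarLayout (F : Set (Set L)) (t : L → ℝ) (ρ : Set L → ℝ) : Prop where
  four_le_radius (A : Set L) : 4 ≤ ρ A
  two_mul_radius_le {A B : Set L} : A ⊂ B → 2 * ρ A ≤ ρ B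
  near {A : Set L} {i j : L} : A ∈ F → i ∈ A → j ∈ A → 4 * (t i - t j) ^ 2 < ρ A
  far {A : Set L} {i j : L} : A ∈ F → i ∉ A → j ∈ A → 8 * ρ A < |t i - t j|
  separated {e f : Sym2 L} : e ≠ f → 1 ≤ |(e.map t).add - (f.map t).add|

namespace IsLaminarLayout

variable {t : L → ℝ} {ρ : Set L → ℝ} (h : IsLaminarLayout F t ρ)
include h

theorem radius_pos (A : Set L) : 0 < ρ A :=
  four_pos.trans_le (h.four_le_radius A)

theorem four_mul_abs_sub_le {A : Set L} (hA : A ∈ F) {i j : L} (hi : i ∈ A) (hj : j ∈ A) :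
    4 * |t i - t j| ≤ ρ A := by
  refine abs_le_of_sq_le_sq' ?_ (h.radius_pos A).le |>.2
  rw [mul_pow, sq_abs]
  nlinarith [h.near hA hi hj, h.four_le_radius A]

theorem injective : t.Injective := by
  intro i j hij
  by_contra hne
  have := h.separated (e := s(i, i)) (f := s(j, j)) (by simpa using hne)
  norm_num [hij] at this

end IsLaminarLayout

open Classical in
/-- The indicator function of the members of `F` that contain the label `i`. -/
noncomputable def incidence (F : Set (Set L)) (i : L) (A : Set L) : ℤ :=
  if A ∈ F ∧ i ∈ A then 1 else 0

/-- The position of the label `i` on the real line: each member `A` of `F` moves the labels in it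
by a distance that is determined by its rank `κ A`. -/
noncomputable def position [Fintype L] (F : Set (Set L)) (κ : Set L → ℕ) (i : L) : ℝ :=
  ∑ A, incidence F i A * (10 * scale (κ A))

theorem abs_incidence_sub_le (i j : L) (A : Set L) :
    |incidence F i A - incidence F j A| ≤ 1 := by
  simp only [incidence]
  split_ifs <;> simp

theorem abs_incidence_add_sub_le (a b d g : L) (A : Set L) :
    |incidence F a A + incidence F b A - (incidence F d A + incidence F g A)| ≤ 2 := by
  rw [add_sub_add_comm]
  exact (abs_add_le _ _).trans
    (add_le_add (abs_incidence_sub_le a d A) (abs_incidence_sub_le b g A))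

theorem mem_of_incidence_sub_ne_zero {i j : L} {A : Set L}
    (h : incidence F i A - incidence F j A ≠ 0) :
    A ∈ F ∧ (i ∈ A ∧ j ∉ A ∨ j ∈ A ∧ i ∉ A) := by
  unfold incidence at h
  split_ifs at h <;> tauto

theorem exists_incidence_add_sub_ne_zero (hsingleton : ∀ i, {i} ∈ F) {a b d g : L}
    (h : s(a, b) ≠ s(d, g)) :
    ∃ A, incidence F a A + incidence F b A - (incidence F d A + incidence F g A) ≠ 0 := by
  classical
  have hinc (i u : L) : incidence F i {u} = if i = u then 1 else 0 := by
    simp only [incidence, hsingleton, Set.mem_singleton_iff, true_and]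
  by_contra! hall
  have hsingle (u : L) := hall {u}
  simp only [hinc] at hsingle
  refine h (Sym2.eq_iff.2 ?_)
  grind [hsingle a, hsingle b, hsingle d, hsingle g]

section Position

variable [Fintype L] {κ : Set L → ℕ}

theorem position_sub_position (i j : L) : position F κ i - position F κ j =
    ∑ A, (incidence F i A - incidence F j A : ℤ) * (10 * scale (κ A)) := by
  simp only [position, ← Finset.sum_sub_distrib, Int.cast_sub, sub_mul]

theorem position_add_sub_position_add (a b d g : L) :
    position F κ a + position F κ b - (position F κ d + position F κ g) =
      ∑ A, (incidence F a A + incidence F b A - (incidence F d A + incidence F g A) : ℤ) *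
        (10 * scale (κ A)) := by
  simp only [position, ← Finset.sum_sub_distrib, ← Finset.sum_add_distrib, Int.cast_sub,
    Int.cast_add, sub_mul, add_mul]

theorem abs_position_sub_le (hF : IsLaminar F) (hκ : κ.Injective) (hmono : StrictMono κ) {A : Set L}
    (hA : A ∈ F) {i j : L} (hi : i ∈ A) (hj : j ∈ A) :
    |position F κ i - position F κ j| ≤ ∑ m ∈ Finset.range (κ A), 10 * scale m := by
  have hscale (C : Set L) (hC : incidence F i C - incidence F j C ≠ 0) : κ C < κ A := by
    obtain ⟨hCF, ⟨hiC, hjC⟩ | ⟨hjC, hiC⟩⟩ := mem_of_incidence_sub_ne_zero hC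
    · exact hmono (hF.ssubset_of_mem_of_notMem hCF hA hi hj hiC hjC)
    · exact hmono (hF.ssubset_of_mem_of_notMem hCF hA hj hi hjC hiC)
  rw [position_sub_position]
  simpa only [Int.cast_one, one_mul] using abs_sum_mul_scale_le hκ Finset.univ zero_le_one
    (abs_incidence_sub_le i j) fun C _ => hscale C

end Position

theorem IsLaminar.exists_isLaminarLayout [Finite L] (hF : IsLaminar F)
    (hsingleton : ∀ i, {i} ∈ F) : ∃ t ρ, IsLaminarLayout F t ρ := by
  classical
  have := Fintype.ofFinite L
  obtain ⟨κ, hκ, hmono⟩ := exists_injective_strictMono_nat (Set L)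
  refine ⟨position F κ, fun A => scale (κ A), fun A => four_le_scale _,
    fun hAB => two_mul_scale_le (hmono hAB), fun {A i j} hA hi hj => ?_,
    fun {A i j} hA hi hj => ?_, fun {e f} hef => ?_⟩
  · have := pow_le_pow_left₀ (abs_nonneg _) (abs_position_sub_le hF hκ hmono hA hi hj) 2
    rw [sq_abs] at this
    linarith [four_mul_sum_scale_sq_lt (κ A)]
  · have hne : incidence F i A - incidence F j A ≠ 0 := by simp [incidence, hA, hi, hj]
    have := nine_mul_scale_le_abs_sum hκ
      (fun C => (abs_incidence_sub_le i j C).trans one_le_two) hne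
    rw [position_sub_position]
    linarith [four_le_scale (κ A)]
  · induction e with | _ a b
    induction f with | _ d g
    obtain ⟨A, hA⟩ := exists_incidence_add_sub_ne_zero hsingleton hef
    have := nine_mul_scale_le_abs_sum hκ (abs_incidence_add_sub_le a b d g) hA
    rw [Sym2.map_mk, Sym2.map_mk, Sym2.add_mk, Sym2.add_mk, position_add_sub_position_add]
    linarith [four_le_scale (κ A)]

end Laminar

section Clustering

variable {L : Type*}

/-- A clustering attaches to every pair of labels a cluster of labels that contains the pair, so
that the clusters are laminar and each is the least cluster that contains its pair. For the leaves
of a rooted tree, the cluster consists of the leaves below the highest node of their path. -/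
structure IsClustering (A : Sym2 L → Set L) : Prop where
  mem {e : Sym2 L} {i : L} : i ∈ e → i ∈ A e
  laminar (e f : Sym2 L) : A e ⊆ A f ∨ A f ⊆ A e ∨ Disjoint (A e) (A f)
  minimal {e f : Sym2 L} : (∀ k ∈ f, k ∈ A e) → A f ⊆ A e

/-- Two pairs are linked if each has a member in the cluster of the other. -/
def Linked (A : Sym2 L → Set L) (e f : Sym2 L) : Prop :=
  (∃ i ∈ e, i ∈ A f) ∧ ∃ k ∈ f, k ∈ A e

/-- The clusters together with the singletons, which serve to separate the labels. -/
def clusterFamily (A : Sym2 L → Set L) : Set (Set L) :=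
  Set.range A ∪ Set.range singleton

theorem mem_clusterFamily (A : Sym2 L → Set L) (e : Sym2 L) : A e ∈ clusterFamily A :=
  .inl ⟨e, rfl⟩

theorem IsClustering.isLaminar_clusterFamily {A : Sym2 L → Set L} (hA : IsClustering A) :
    IsLaminar (clusterFamily A) := by
  have singleton_or (i : L) (B : Set L) : {i} ⊆ B ∨ Disjoint {i} B := by
    rw [Set.singleton_subset_iff, Set.disjoint_singleton_left]
    exact em _
  rintro _ (⟨e, rfl⟩ | ⟨i, rfl⟩) B hB
  · rcases hB with ⟨f, rfl⟩ | ⟨j, rfl⟩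
    · exact hA.laminar e f
    · exact .inr ((singleton_or j (A e)).imp_right fun hd => hd.symm)
  · exact (singleton_or i B).imp_right .inr

/-- The part of the secant through the two labels in `e` that lies over the interval of radius
`ρ (A e)` around one of them. -/
noncomputable def chord (t : L → ℝ) (ρ : Set L → ℝ) (A : Sym2 L → Set L) (e : Sym2 L) :
    Set Plane :=
  lineSegment (e.map t).add (-(e.map t).mul) (t e.out.1 - ρ (A e)) (t e.out.1 + ρ (A e))

/-- The point of the parabola `y = x ^ 2` that represents a label. -/
noncomputable def labelPoint (t : L → ℝ) (i : L) : Plane :=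
  !₂[t i, t i ^ 2]

/-- The lines of two chords have different slopes and meet over an inner point of both intervals. -/
def ChordsCross (t : L → ℝ) (ρ : Set L → ℝ) (A : Sym2 L → Set L) (e f : Sym2 L) : Prop :=
  (e.map t).add ≠ (f.map t).add ∧ ∃ x, |x - t e.out.1| < ρ (A e) ∧ |x - t f.out.1| < ρ (A f) ∧
    secant (e.map t) x = secant (f.map t) x

variable {t : L → ℝ} {ρ : Set L → ℝ} {A : Sym2 L → Set L} {e f : Sym2 L}

theorem mem_chord_iff {p : Plane} :
    p ∈ chord t ρ A e ↔ |p 0 - t e.out.1| ≤ ρ (A e) ∧ p 1 = secant (e.map t) (p 0) := by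
  rw [abs_sub_comm, Set.mem_Icc_iff_abs_le, secant, sub_eq_add_neg (_ * _)]
  rfl

theorem ChordsCross.symm (h : ChordsCross t ρ A e f) : ChordsCross t ρ A f e := by
  obtain ⟨hslope, x, hxe, hxf, hx⟩ := h
  exact ⟨hslope.symm, x, hxf, hxe, hx.symm⟩

theorem ChordsCross.exists_crossAt (h : ChordsCross t ρ A e f) :
    ∃ z, chord t ρ A e ∩ chord t ρ A f = {z} ∧ CrossAt (chord t ρ A e) (chord t ρ A f) z := by
  obtain ⟨hslope, x, hxe, hxf, hx⟩ := h
  have mem_Ioo {c r : ℝ} (h : |x - c| < r) : x ∈ Set.Ioo (c - r) (c + r) := by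
    obtain ⟨h₁, h₂⟩ := abs_lt.1 h
    exact ⟨by linarith, by linarith⟩
  have hz : (!₂[x, secant (e.map t) x] : Plane) ∈ chord t ρ A e := mem_chord_iff.2 ⟨hxe.le, rfl⟩
  have hz' : (!₂[x, secant (e.map t) x] : Plane) ∈ chord t ρ A f := mem_chord_iff.2 ⟨hxf.le, hx⟩
  exact ⟨_, lineSegment_inter_lineSegment hslope hz hz',
    crossAt_lineSegment hslope (mem_Ioo hxe) (mem_Ioo hxf) hz.2 hz'.2⟩

section Layout

variable (h : IsLaminarLayout (clusterFamily A) t ρ) (hA : IsClustering A)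
include h

theorem isJordanArc_chord (e : Sym2 L) : IsJordanArc (chord t ρ A e) :=
  isJordanArc_lineSegment (by linarith [h.radius_pos (A e)])

include hA

theorem four_mul_abs_sub_out_le {i : L} (hi : i ∈ A e) : 4 * |t i - t e.out.1| ≤ ρ (A e) :=
  h.four_mul_abs_sub_le (mem_clusterFamily A e) hi (hA.mem e.out_fst_mem)

theorem four_mul_abs_sub_out_le_of_mem_map :
    ∀ a ∈ e.map t, 4 * |a - t e.out.1| ≤ ρ (A e) := by
  intro _ ha
  obtain ⟨i, hi, rfl⟩ := Sym2.mem_map.1 ha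
  exact four_mul_abs_sub_out_le h hA (hA.mem hi)

theorem labelPoint_mem_chord_iff {k : L} : labelPoint t k ∈ chord t ρ A e ↔ k ∈ e := by
  have hsecant : labelPoint t k 1 = secant (e.map t) (labelPoint t k 0) ↔ k ∈ e :=
    sq_eq_secant_iff.trans (Sym2.mem_map.trans (by simp only [h.injective.eq_iff, exists_eq_right]))
  rw [mem_chord_iff, hsecant, and_iff_right_iff_imp]
  intro hk
  exact (by linarith [four_mul_abs_sub_out_le h hA (hA.mem hk), abs_nonneg (t k - t e.out.1)] :
    |t k - t e.out.1| ≤ ρ (A e))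

theorem chordsCross_of_subset_of_subset (hef : e ≠ f) (he : ∀ k ∈ e, k ∈ A f)
    (hf : ∀ k ∈ f, k ∈ A e) : ChordsCross t ρ A e f := by
  have hAA : A e = A f := (hA.minimal he).antisymm (hA.minimal hf)
  have near (g : Sym2 L) (hg : ∀ k ∈ g, k ∈ A e) :
      ∀ a ∈ g.map t, 4 * (a - t e.out.1) ^ 2 < ρ (A e) := by
    intro _ ha
    obtain ⟨k, hk, rfl⟩ := Sym2.mem_map.1 ha
    exact h.near (mem_clusterFamily A e) (hg k hk) (hA.mem e.out_fst_mem)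
  have hsep := h.separated hef
  obtain ⟨x, hx, hsecant⟩ :=
    exists_secant_eq_secant_of_near (near e fun _ => hA.mem) (near f hf) hsep
  have hcenter := four_mul_abs_sub_out_le h hA (hf _ f.out_fst_mem)
  have := abs_sub_le x (t e.out.1) (t f.out.1)
  rw [abs_sub_comm] at hcenter
  refine ⟨fun heq => by norm_num [heq] at hsep, x, ?_, ?_, hsecant⟩
  · linarith [abs_nonneg (x - t e.out.1)]
  · rw [← hAA]
    linarith [h.radius_pos (A e)]

theorem chordsCross_of_mem_of_notMem {k l : L} (hk : k ∈ f) (hkA : k ∈ A e) (hl : l ∈ f)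
    (hlA : l ∉ A e) : ChordsCross t ρ A e f := by
  have hkl : k ≠ l := by rintro rfl; exact hlA hkA
  obtain rfl := (Sym2.mem_and_mem_iff hkl).1 ⟨hk, hl⟩
  have hsub : A e ⊂ A s(k, l) :=
    hA.isLaminar_clusterFamily.ssubset_of_mem_of_notMem (mem_clusterFamily A e)
      (mem_clusterFamily A _) (hA.mem hk) (hA.mem hl) hkA hlA
  have hnear := four_mul_abs_sub_out_le_of_mem_map h hA (e := e)
  have hk_near := four_mul_abs_sub_out_le h hA hkA
  have hl_far := h.far (mem_clusterFamily A e) hlA (hA.mem e.out_fst_mem)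
  have hcenter := four_mul_abs_sub_out_le h hA (hsub.subset (hA.mem e.out_fst_mem))
  obtain ⟨x, hx, hsecant⟩ :=
    exists_secant_eq_secant_of_near_far (h.radius_pos _) hnear hk_near hl_far
  have := abs_sub_le x (t e.out.1) (t s(k, l).out.1)
  refine ⟨add_ne_add_of_near_far hnear hk_near hl_far, x, hx, ?_, hsecant⟩
  linarith [h.two_mul_radius_le hsub, h.radius_pos (A s(k, l))]

theorem chordsCross_of_linked (hef : e ≠ f) (hlink : Linked A e f) : ChordsCross t ρ A e f := by
  obtain ⟨⟨i, hi, hiA⟩, k, hk, hkA⟩ := hlink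
  by_cases hf : ∀ l ∈ f, l ∈ A e
  · by_cases he : ∀ l ∈ e, l ∈ A f
    · exact chordsCross_of_subset_of_subset h hA hef he hf
    · push Not at he
      obtain ⟨l, hl, hlA⟩ := he
      exact (chordsCross_of_mem_of_notMem h hA hi hiA hl hlA).symm
  · push Not at hf
    obtain ⟨l, hl, hlA⟩ := hf
    exact chordsCross_of_mem_of_notMem h hA hk hkA hl hlA

theorem disjoint_chord_of_forall_notMem (hf : ∀ k ∈ f, k ∉ A e) :
    Disjoint (chord t ρ A e) (chord t ρ A f) := by
  have hfar : ∀ d ∈ f.map t, 8 * ρ (A e) < |d - t e.out.1| := by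
    intro _ hd
    obtain ⟨k, hk, rfl⟩ := Sym2.mem_map.1 hd
    exact h.far (mem_clusterFamily A e) (hf k hk) (hA.mem e.out_fst_mem)
  refine Set.disjoint_left.2 fun p hpe hpf => ?_
  obtain ⟨hx, hpe⟩ := mem_chord_iff.1 hpe
  obtain ⟨-, hpf⟩ := mem_chord_iff.1 hpf
  exact secant_ne_secant_of_far (four_mul_abs_sub_out_le_of_mem_map h hA) hfar hx
    (hpe.symm.trans hpf)

theorem disjoint_chord_of_not_linked (hlink : ¬ Linked A e f) :
    Disjoint (chord t ρ A e) (chord t ρ A f) := by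
  rcases not_and_or.1 hlink with he | hf
  · exact (disjoint_chord_of_forall_notMem h hA fun i hi hiA => he ⟨i, hi, hiA⟩).symm
  · exact disjoint_chord_of_forall_notMem h hA fun k hk hkA => hf ⟨k, hk, hkA⟩

end Layout

section Realization

variable {V α : Type*} {P : V → Set α} {s : V → Set Plane}

theorem isPSIRepresentation_intersectionGraph (harc : ∀ v, IsJordanArc (s v))
    (hcross : ∀ v w, v ≠ w → (P v ∩ P w).Nonempty → ∃ x, s v ∩ s w = {x} ∧ CrossAt (s v) (s w) x)
    (hdisj : ∀ v w, ¬ (P v ∩ P w).Nonempty → Disjoint (s v) (s w)) :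
    IsPSIRepresentation (intersectionGraph P) s := by
  refine ⟨⟨harc, fun v w hvw => ?_⟩, ?_⟩
  · exact (em (P v ∩ P w).Nonempty).symm.imp (hdisj v w) (hcross v w hvw)
  · ext v w
    refine and_congr_right fun hvw => ⟨fun hP => ?_, fun hs => ?_⟩
    · obtain ⟨x, hx, -⟩ := hcross v w hvw hP
      exact hx ▸ Set.singleton_nonempty x
    · by_contra hP
      exact Set.not_disjoint_iff_nonempty_inter.2 hs (hdisj v w hP)

theorem IsPSIRepresentation.comp_injective {ι : Type*}
    (h : IsPSIRepresentation (intersectionGraph P) s) {g : ι → V} (hg : g.Injective) :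
    IsPSIRepresentation (intersectionGraph (P ∘ g)) (s ∘ g) := by
  refine ⟨⟨fun i => h.1.1 (g i), fun i j hij => h.1.2 _ _ (hg.ne hij)⟩, ?_⟩
  ext i j
  have := congrArg (fun G => G.Adj (g i) (g j)) h.2
  simpa only [intersectionGraph, hg.ne_iff, eq_iff_iff, Function.comp_apply] using this

end Realization

/-- The disks with centres `c i` and radii `r i` localize the crossings of the arcs at the labels:
they are pairwise disjoint, an arc meets exactly the disks of its own labels, each in an arc, and
any two arcs that meet the same disk cross in its interior. -/
def HasLabelDisks (s : Sym2 L → Set Plane) (c : L → Plane) (r : L → ℝ) : Prop :=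
  (∀ i, 0 < r i) ∧
  (∀ i j, i ≠ j → Disjoint (Metric.closedBall (c i) (r i)) (Metric.closedBall (c j) (r j))) ∧
  (∀ e k, (s e ∩ Metric.closedBall (c k) (r k)).Nonempty ↔ k ∈ e) ∧
  (∀ e, ∀ k ∈ e, IsJordanArc (s e ∩ Metric.closedBall (c k) (r k))) ∧
  (∀ e f k, e ≠ f →
    (s e ∩ Metric.closedBall (c k) (r k)).Nonempty →
    (s f ∩ Metric.closedBall (c k) (r k)).Nonempty →
    ∃ x ∈ Metric.ball (c k) (r k), x ∈ s e ∩ s f ∧ CrossAt (s e) (s f) x)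

theorem labelPoint_injective (ht : t.Injective) : (labelPoint t).Injective := fun _ _ hij =>
  ht (congrArg (fun p : Plane => p 0) hij)

theorem isJordanArc_chord_inter_closedBall (h : IsLaminarLayout (clusterFamily A) t ρ)
    (hA : IsClustering A) {k : L} (hk : k ∈ e) {r : ℝ} (hr : 0 < r) :
    IsJordanArc (chord t ρ A e ∩ Metric.closedBall (labelPoint t k) r) := by
  have hlt : |t k - t e.out.1| < ρ (A e) := by
    linarith [four_mul_abs_sub_out_le h hA (hA.mem hk), abs_nonneg (t k - t e.out.1),
      h.radius_pos (A e)]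
  obtain ⟨hlow, hhigh⟩ := abs_lt.1 hlt
  exact isJordanArc_lineSegment_inter_closedBall
    (show t k ∈ Set.Ioo _ _ from ⟨by linarith, by linarith⟩)
    ((labelPoint_mem_chord_iff h hA).2 hk).2 hr

theorem exists_hasLabelDisks_chord [Finite L] (h : IsLaminarLayout (clusterFamily A) t ρ)
    (hA : IsClustering A) : ∃ r, HasLabelDisks (chord t ρ A) (labelPoint t) r := by
  obtain ⟨r, hr, hballs, hfar⟩ := exists_radius_disjoint_closedBall
    (labelPoint_injective h.injective) (s := chord t ρ A) fun _ => isClosed_lineSegment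
  have meets_iff (e : Sym2 L) (k : L) :
      (chord t ρ A e ∩ Metric.closedBall (labelPoint t k) r).Nonempty ↔ k ∈ e := by
    rw [← labelPoint_mem_chord_iff h hA (k := k)]
    refine ⟨fun hne => ?_, fun hk => ⟨_, hk, Metric.mem_closedBall_self hr.le⟩⟩
    by_contra hk
    exact Set.not_disjoint_iff_nonempty_inter.2 hne (hfar e k hk)
  refine ⟨fun _ => r, fun _ => hr, hballs, meets_iff,
    fun e k hk => isJordanArc_chord_inter_closedBall h hA hk hr, fun e f k hef he hf => ?_⟩
  rw [meets_iff] at he hf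
  have hk : labelPoint t k ∈ chord t ρ A e ∩ chord t ρ A f :=
    ⟨(labelPoint_mem_chord_iff h hA).2 he, (labelPoint_mem_chord_iff h hA).2 hf⟩
  obtain ⟨z, hz, hcross⟩ :=
    (chordsCross_of_linked h hA hef ⟨⟨k, he, hA.mem hf⟩, k, hf, hA.mem he⟩).exists_crossAt
  obtain rfl : labelPoint t k = z := by rwa [hz] at hk
  exact ⟨_, Metric.mem_ball_self hr, hk, hcross⟩

theorem IsClustering.exists_isPSIRepresentation_hasLabelDisks [Finite L] (hA : IsClustering A)
    {α : Type*} {P : Sym2 L → Set α} (hP : ∀ e f, (P e ∩ P f).Nonempty ↔ Linked A e f) :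
    ∃ s c r, IsPSIRepresentation (intersectionGraph P) s ∧ HasLabelDisks s c r := by
  obtain ⟨t, ρ, h⟩ := hA.isLaminar_clusterFamily.exists_isLaminarLayout fun i => .inr ⟨i, rfl⟩
  obtain ⟨r, hr⟩ := exists_hasLabelDisks_chord h hA
  refine ⟨chord t ρ A, labelPoint t, r, ?_, hr⟩
  refine isPSIRepresentation_intersectionGraph (isJordanArc_chord h) (fun e f hef hne => ?_)
    fun e f hne => ?_
  · exact (chordsCross_of_linked h hA hef ((hP e f).1 hne)).exists_crossAt
  · exact disjoint_chord_of_not_linked h hA (mt (hP e f).2 hne)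

end Clustering

section Forest

variable {N : Type*} [SemilatticeInf N]

/-- The nodes of the path between the two nodes in `e`, in a rooted tree whose nodes are ordered so
that `u ≤ v` if `u` is an ancestor of `v`; the infimum of `e` is the highest node of the path. -/
def geodesic (e : Sym2 N) : Set N :=
  {w | e.inf ≤ w ∧ ∃ u ∈ e, w ≤ u}

theorem inf_le_of_mem {e : Sym2 N} {u : N} (hu : u ∈ e) : e.inf ≤ u := by
  induction e with | _ a b
  rcases Sym2.mem_iff.1 hu with rfl | rfl
  · exact inf_le_left
  · exact inf_le_right

theorem le_inf_of_forall_mem {e : Sym2 N} {c : N} (hc : ∀ u ∈ e, c ≤ u) : c ≤ e.inf := by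
  induction e with | _ a b
  exact le_inf (hc a (Sym2.mem_mk_left a b)) (hc b (Sym2.mem_mk_right a b))

/-- The labels that lie below the highest node of the path between the labels in `e`. -/
def cluster {L : Type*} (π : L → N) (e : Sym2 L) : Set L :=
  {k | (e.map π).inf ≤ π k}

variable (hforest : ∀ c : N, IsChain (· ≤ ·) (Set.Iic c))
include hforest

theorem geodesic_inter_nonempty_iff {e f : Sym2 N} :
    (geodesic e ∩ geodesic f).Nonempty ↔ (∃ u ∈ e, f.inf ≤ u) ∧ ∃ v ∈ f, e.inf ≤ v := by
  constructor
  · rintro ⟨w, ⟨hew, u, hu, hwu⟩, hfw, v, hv, hwv⟩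
    exact ⟨⟨u, hu, hfw.trans hwu⟩, v, hv, hew.trans hwv⟩
  · rintro ⟨⟨u, hu, hfu⟩, v, hv, hev⟩
    rcases (hforest u).total (inf_le_of_mem hu) hfu with hle | hle
    · exact ⟨f.inf, ⟨hle, u, hu, hfu⟩, le_rfl, v, hv, inf_le_of_mem hv⟩
    · exact ⟨e.inf, ⟨le_rfl, u, hu, inf_le_of_mem hu⟩, hle, v, hv, hev⟩

variable {L : Type*} (π : L → N)

theorem isClustering_cluster : IsClustering (cluster π) where
  mem hi := inf_le_of_mem (Sym2.mem_map.2 ⟨_, hi, rfl⟩)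
  laminar e f := by
    by_cases hdisj : Disjoint (cluster π e) (cluster π f)
    · exact .inr (.inr hdisj)
    · obtain ⟨k, hke, hkf⟩ := Set.not_disjoint_iff.1 hdisj
      rcases (hforest (π k)).total hke hkf with hle | hle
      · exact .inr (.inl fun _ hl => hle.trans hl)
      · exact .inl fun _ hl => hle.trans hl
  minimal hf _ hk := le_trans (le_inf_of_forall_mem fun _ hu => by
    obtain ⟨i, hi, rfl⟩ := Sym2.mem_map.1 hu
    exact hf i hi) hk

theorem geodesic_map_inter_nonempty_iff {e f : Sym2 L} :
    (geodesic (e.map π) ∩ geodesic (f.map π)).Nonempty ↔ Linked (cluster π) e f := by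
  simp only [geodesic_inter_nonempty_iff hforest, Linked, cluster, Sym2.mem_map,
    exists_exists_and_eq_and, Set.mem_ofPred_eq]

end Forest

section RootedTree

variable {W : Type*} {T : SimpleGraph W} {r a b c u v w : W}

/-- `a` is an ancestor of `b` in the tree `T` with root `r`: it lies on the path from `r` to `b`. -/
def IsAncestor (T : SimpleGraph W) (r a b : W) : Prop :=
  ∃ p : T.Walk r b, p.IsPath ∧ a ∈ p.support

theorem isAncestor_iff_mem_support (hT : T.IsTree) {p : T.Walk r b} (hp : p.IsPath) :
    IsAncestor T r a b ↔ a ∈ p.support := by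
  constructor
  · rintro ⟨q, hq, ha⟩
    rwa [(hT.existsUnique_path r b).unique hp hq]
  · exact fun ha => ⟨p, hp, ha⟩

theorem isAncestor_refl (hT : T.IsTree) (r a : W) : IsAncestor T r a a := by
  obtain ⟨p, hp, -⟩ := hT.existsUnique_path r a
  exact ⟨p, hp, p.end_mem_support⟩

theorem isAncestor_root (hT : T.IsTree) (r a : W) : IsAncestor T r r a := by
  obtain ⟨p, hp, -⟩ := hT.existsUnique_path r a
  exact ⟨p, hp, p.start_mem_support⟩

namespace IsAncestor

theorem trans (hT : T.IsTree) (hab : IsAncestor T r a b) (hbc : IsAncestor T r b c) :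
    IsAncestor T r a c := by
  classical
  obtain ⟨p, hp, hb⟩ := hbc
  rw [isAncestor_iff_mem_support hT (hp.takeUntil hb)] at hab
  exact ⟨p, hp, p.support_takeUntil_subset_support hb hab⟩

theorem antisymm (hT : T.IsTree) (hab : IsAncestor T r a b) (hba : IsAncestor T r b a) :
    a = b := by
  classical
  obtain ⟨p, hp, ha⟩ := hab
  by_contra hne
  rw [isAncestor_iff_mem_support hT (hp.takeUntil ha)] at hba
  exact SimpleGraph.Walk.endpoint_notMem_support_takeUntil hp ha (Ne.symm hne) hba

end IsAncestor

theorem mem_support_iff_of_isPath_append (hT : T.IsTree) {q : T.Walk r a} {s : T.Walk a u}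
    (h : (q.append s).IsPath) : w ∈ s.support ↔ IsAncestor T r a w ∧ IsAncestor T r w u := by
  classical
  constructor
  · intro hw
    have hs : (q.append (s.takeUntil w hw)).append (s.dropUntil w hw) = q.append s := by
      rw [← SimpleGraph.Walk.append_assoc, SimpleGraph.Walk.take_spec]
    refine ⟨⟨q.append (s.takeUntil w hw), ?_, ?_⟩, q.append s, h, ?_⟩
    · rw [← hs] at h
      exact h.of_append_left
    · exact SimpleGraph.Walk.support_subset_support_append_left _ _ q.end_mem_support
    · exact SimpleGraph.Walk.support_subset_support_append_right _ _ hw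
  · rintro ⟨haw, hwu⟩
    rw [isAncestor_iff_mem_support hT h, SimpleGraph.Walk.mem_support_append_iff] at hwu
    rcases hwu with hw | hw
    · obtain rfl := IsAncestor.antisymm hT ⟨q, h.of_append_left, hw⟩ haw
      exact s.start_mem_support
    · exact hw

theorem IsAncestor.total (hT : T.IsTree) (hac : IsAncestor T r a c) (hbc : IsAncestor T r b c) :
    IsAncestor T r a b ∨ IsAncestor T r b a := by
  classical
  obtain ⟨p, hp, ha⟩ := hac
  have happend : ((p.takeUntil a ha).append (p.dropUntil a ha)).IsPath := by rwa [p.take_spec ha]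
  rw [isAncestor_iff_mem_support hT happend, SimpleGraph.Walk.mem_support_append_iff] at hbc
  rcases hbc with hb | hb
  · exact .inr ⟨_, hp.takeUntil ha, hb⟩
  · exact .inl ((mem_support_iff_of_isPath_append hT happend).1 hb).1

theorem exists_greatest_common_ancestor (hT : T.IsTree) (r u v : W) :
    ∃ a, IsAncestor T r a u ∧ IsAncestor T r a v ∧
      ∀ c, IsAncestor T r c u → IsAncestor T r c v → IsAncestor T r c a := by
  let : Preorder W :=
    { le := IsAncestor T r, le_refl := isAncestor_refl hT r, le_trans _ _ _ := IsAncestor.trans hT }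
  obtain ⟨p, hp, -⟩ := hT.existsUnique_path r u
  have hfinite : {c | IsAncestor T r c u ∧ IsAncestor T r c v}.Finite :=
    p.support.finite_toSet.subset fun c hc => (isAncestor_iff_mem_support hT hp).1 hc.1
  obtain ⟨a, ha⟩ := hfinite.exists_maximal ⟨r, isAncestor_root hT r u, isAncestor_root hT r v⟩
  refine ⟨a, ha.1.1, ha.1.2, fun c hu hv => ?_⟩
  rcases hu.total hT ha.1.1 with hca | hac
  · exact hca
  · exact ha.2 ⟨hu, hv⟩ hac

theorem mem_support_iff_of_greatest_common_ancestor (hT : T.IsTree) (hu : IsAncestor T r a u)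
    (hv : IsAncestor T r a v)
    (ha : ∀ c, IsAncestor T r c u → IsAncestor T r c v → IsAncestor T r c a)
    {p : T.Walk u v} (hp : p.IsPath) :
    w ∈ p.support ↔ IsAncestor T r a w ∧ (IsAncestor T r w u ∨ IsAncestor T r w v) := by
  classical
  obtain ⟨p₁, hp₁, ha₁⟩ := hu
  obtain ⟨p₂, hp₂, ha₂⟩ := hv
  rw [← p₁.take_spec ha₁] at hp₁
  rw [← p₂.take_spec ha₂] at hp₂
  have hmem₁ (x : W) := mem_support_iff_of_isPath_append (w := x) hT hp₁
  have hmem₂ (x : W) := mem_support_iff_of_isPath_append (w := x) hT hp₂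
  have hnodup₂ := hp₂.of_append_right.support_nodup
  have hpath : ((p₁.dropUntil a ha₁).reverse.append (p₂.dropUntil a ha₂)).IsPath := by
    rw [SimpleGraph.Walk.isPath_def, SimpleGraph.Walk.support_append, List.nodup_append']
    refine ⟨hp₁.of_append_right.reverse.support_nodup, hnodup₂.tail, fun x hx₁ hx₂ => ?_⟩
    rw [SimpleGraph.Walk.support_reverse, List.mem_reverse, hmem₁] at hx₁
    have hxv := ((hmem₂ x).1 (List.mem_of_mem_tail hx₂)).2
    obtain rfl : x = a := IsAncestor.antisymm hT (ha x hx₁.2 hxv) hx₁.1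
    rw [← SimpleGraph.Walk.cons_tail_support] at hnodup₂
    exact (List.nodup_cons.1 hnodup₂).1 hx₂
  rw [(hT.existsUnique_path u v).unique hp hpath, SimpleGraph.Walk.mem_support_append_iff,
    SimpleGraph.Walk.support_reverse, List.mem_reverse, hmem₁, hmem₂, and_or_left]

theorem exists_semilatticeInf_support_eq_geodesic (hT : T.IsTree) :
    ∃ _ : SemilatticeInf W, (∀ c : W, IsChain (· ≤ ·) (Set.Iic c)) ∧
      ∀ (u v : W) (p : T.Walk u v), p.IsPath → {w | w ∈ p.support} = geodesic s(u, v) := by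
  obtain ⟨r⟩ := hT.1.nonempty
  choose m hmu hmv hm using exists_greatest_common_ancestor hT r
  let order : SemilatticeInf W :=
    { le := IsAncestor T r
      le_refl := isAncestor_refl hT r
      le_trans _ _ _ := IsAncestor.trans hT
      le_antisymm _ _ := IsAncestor.antisymm hT
      inf := m
      inf_le_left := hmu
      inf_le_right := hmv
      le_inf c u v := hm u v c }
  refine ⟨order, fun c a ha b hb _ => IsAncestor.total hT ha hb, fun u v p hp => ?_⟩
  ext w
  rw [Set.mem_ofPred_eq,
    mem_support_iff_of_greatest_common_ancestor hT (hmu u v) (hmv u v) (hm u v) hp, geodesic,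
    Set.mem_ofPred_eq]
  simp only [Sym2.mem_iff, exists_eq_or_imp, exists_eq_left]
  rfl

end RootedTree

section LabelPath

variable {W L : Type*} {T : SimpleGraph W}

/-- For labels attached to nodes of the tree `T` by `π`, the vertex set of the path between the
nodes that carry the two labels in `e`. -/
def labelPath (T : SimpleGraph W) (π : L → W) (e : Sym2 L) : Set W :=
  {w | ∃ (a b : L) (p : T.Walk (π a) (π b)), e = s(a, b) ∧ p.IsPath ∧ w ∈ p.support}

theorem labelPath_mk (hT : T.IsTree) (π : L → W) {i j : L} {p : T.Walk (π i) (π j)}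
    (hp : p.IsPath) : labelPath T π s(i, j) = {w | w ∈ p.support} := by
  ext w
  constructor
  · rintro ⟨a, b, q, he, hq, hw⟩
    rcases Sym2.eq_iff.1 he with ⟨rfl, rfl⟩ | ⟨rfl, rfl⟩
    · rwa [(hT.existsUnique_path _ _).unique hq hp] at hw
    · rwa [← (hT.existsUnique_path _ _).unique hq.reverse hp, Set.mem_ofPred_eq,
        SimpleGraph.Walk.support_reverse, List.mem_reverse]
  · exact fun hw => ⟨i, j, p, rfl, hp, hw⟩

theorem exists_isPSIRepresentation_labelPath [Finite L] (hT : T.IsTree) (π : L → W) :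
    ∃ s c r, IsPSIRepresentation (intersectionGraph (labelPath T π)) s ∧ HasLabelDisks s c r := by
  obtain ⟨_, hforest, hpath⟩ := exists_semilatticeInf_support_eq_geodesic hT
  have hgeodesic (e : Sym2 L) : labelPath T π e = geodesic (e.map π) := by
    induction e with | _ i j
    obtain ⟨p, hp, -⟩ := hT.existsUnique_path (π i) (π j)
    rw [labelPath_mk hT π hp, hpath _ _ p hp, Sym2.map_mk]
  refine (isClustering_cluster hforest π).exists_isPSIRepresentation_hasLabelDisks fun e f => ?_
  rw [hgeodesic, hgeodesic, geodesic_map_inter_nonempty_iff hforest]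

theorem exists_isPSIRepresentation_of_isPathVertexSet {V : Type*} [Finite V] (hT : T.IsTree)
    {P : V → Set W} (hP : ∀ v, IsPathVertexSet T (P v)) :
    ∃ s, IsPSIRepresentation (intersectionGraph P) s := by
  choose a b p hp hPp using hP
  let endpoints (v : V) : Sym2 (V ⊕ V) := s(.inl v, .inr v)
  have hinj : endpoints.Injective := fun v w h => by simpa [endpoints] using h
  have hlabel : labelPath T (Sum.elim a b) ∘ endpoints = P := funext fun v => by
    rw [hPp v]
    exact labelPath_mk hT (Sum.elim a b) (i := .inl v) (j := .inr v) (hp v)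
  obtain ⟨s, -, -, hs, -⟩ := exists_isPSIRepresentation_labelPath hT (Sum.elim a b)
  exact ⟨s ∘ endpoints, hlabel ▸ hs.comp_injective hinj⟩

end LabelPath

theorem theorem1_general {W : Type*} {T : SimpleGraph W} (hT : T.IsTree) :
    (∀ (V : Type*) [Finite V] (P : V → Set W), (∀ v, IsPathVertexSet T (P v)) →
      ∃ s, IsPSIRepresentation (intersectionGraph P) s) ∧
    (∀ (L : Type*) [Finite L] (π : L → W), ∃ s c r,
      IsPSIRepresentation (intersectionGraph (labelPath T π)) s ∧ HasLabelDisks s c r) :=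
  ⟨fun _ _ _ hP => exists_isPSIRepresentation_of_isPathVertexSet hT hP,
    fun _ _ π => exists_isPSIRepresentation_labelPath hT π⟩

theorem theorem1 :
    (∀ (V : Type*) [Finite V] (G : SimpleGraph V), IsVPT G →
      ∃ s : V → Set Plane, IsPSIRepresentation G s) ∧
    (∀ (W : Type*) [Finite W] (T : SimpleGraph W), T.IsTree →
      ∃ (s : Sym2 (Leaf T) → Set Plane) (c : Leaf T → Plane) (r : Leaf T → ℝ),
        IsPSIRepresentation (intersectionGraph (leafPath T)) s ∧
        (∀ i, 0 < r i) ∧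
        (∀ i j, i ≠ j →
          Disjoint (Metric.closedBall (c i) (r i)) (Metric.closedBall (c j) (r j))) ∧
        (∀ e k, (s e ∩ Metric.closedBall (c k) (r k)).Nonempty ↔ k ∈ e) ∧
        (∀ e, ∀ k ∈ e, IsJordanArc (s e ∩ Metric.closedBall (c k) (r k))) ∧
        (∀ e f k, e ≠ f →
          (s e ∩ Metric.closedBall (c k) (r k)).Nonempty →
          (s f ∩ Metric.closedBall (c k) (r k)).Nonempty →
          ∃ x ∈ Metric.ball (c k) (r k), x ∈ s e ∩ s f ∧ CrossAt (s e) (s f) x)) := by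
  exact ⟨fun V _ _ ⟨_, _, _, P, hT, hP, hG⟩ => hG ▸ (theorem1_general.{0, _, 0} hT).1 V P hP,
    fun _ _ T hT => (theorem1_general.{_, 0, _} hT).2 (Leaf T) Subtype.val⟩
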